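/- All graphs are finite, simple, undirected and have at least one vertex. For a positive integer $q$, a star $q$-coloring of a graph $G$ is a function $f\colon V(G)\to\mathbb{Z}_q$ such that (i) $f(u)\neq f(v)$ for every edge $uv$ of $G$, and (ii) there is no path $u,v,w,x$ on four distinct vertices in $G$ with $f(u)=f(w)$ and $f(v)=f(x)$; $G$ is star $q$-colorable if it has a star $q$-coloring. A graph is $K_{1,r}$-free if it has no induced subgraph isomorphic to the star $K_{1,r}$. For a graph $H$, let $L^*(H)$ be the graph whose vertices are the ordered pairs $(u,v)$ with $uv\in E(H)$, in which $(u,v)$ and $(v,w)$ are adjacent whenever $uv, vw\in E(H)$ and $u\neq w$ (and there are no other adjacencies); that is, the underlying undirected graph of the oriented line graph of $H$. The characteristic polynomial of a graph is that of its adjacency matrix. **Theorem.** Let $p\geq 2$ be an integer, and let $G$ be a $K_{1,p+1}$-free $2p$-regular graph that is star $(p+2)$-colorable. Then the characteristic polynomial of $G$ is divisible in $\mathbb{Z}[x]$ by $$(x-2p)\,(x+2)^{(p-1)(p+2)/2}\,(x-2)^{p(p+1)/2}\,(x-p+2)^{p+1}\,(x+p)^{p+1}.$$ Moreover, this polynomial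 is the characteristic polynomial of $L^*(K_{p+2})$. -/

import Mathlib

namespace SimpleGraph

/-- The oriented line graph of `G`: its vertices are the ordered pairs `(u, v)` with `uv` an edge
of `G`, and there is an arc from `(u, v)` to `(v, w)` when `u ≠ w`. -/
def orientedLineGraph {V : Type*} (G : SimpleGraph V) : Digraph G.Dart where
  Adj a b := a.snd = b.fst ∧ a.fst ≠ b.snd

/-- `L*(G)`, the underlying undirected graph of the oriented line graph of `G`. -/
def lineGraphStar {V : Type*} (G : SimpleGraph V) : SimpleGraph G.Dart :=
  G.orientedLineGraph.toSimpleGraphInclusive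

instance {V : Type*} [DecidableEq V] (G : SimpleGraph V) : DecidableRel G.lineGraphStar.Adj :=
  fun a b => inferInstanceAs (Decidable (a ≠ b ∧
    ((a.snd = b.fst ∧ a.fst ≠ b.snd) ∨ (b.snd = a.fst ∧ b.fst ≠ a.snd))))

/-- A star `q`-coloring of `G`: a proper coloring with colors in `ℤ/qℤ` such that no path
`u, v, w, x` on four (distinct) vertices of `G` has `f u = f w` and `f v = f x`. -/
structure IsStarColoring {V : Type*} (G : SimpleGraph V) (q : ℕ) (f : V → ZMod q) : Prop where
  proper : ∀ u v, G.Adj u v → f u ≠ f v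
  no_bicolored_path : ∀ u v w x, G.Adj u v → G.Adj v w → G.Adj w x →
    [u, v, w, x].Nodup → ¬ (f u = f w ∧ f v = f x)

/-- `G` is star `q`-colorable. -/
def StarColorable {V : Type*} (G : SimpleGraph V) (q : ℕ) : Prop :=
  ∃ f : V → ZMod q, G.IsStarColoring q f

/-- `G` is `K_{1,r}`-free: it has no induced subgraph isomorphic to the star `K_{1,r}`. -/
def StarFree {V : Type*} (G : SimpleGraph V) (r : ℕ) : Prop :=
  ¬ (completeBipartiteGraph (Fin 1) (Fin r)).IsIndContained G

end SimpleGraph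

/-! Weight each ordered adjacency `(u, v)` by the reciprocal of the number of neighbors of `u`
colored like `v`. The weights at `u` sum to the number of colors seen from `u`, at most `p + 1`. On
an edge, one of the two weights is `1` (star coloring) and the other is at least `1/p`
(`K_{1,p+1}`-freeness). With degree `2p` the two bounds on the total coincide, so all these
inequalities are equalities (`IsStarColoring.extremal`).

Hence each vertex `v` has exactly one color `h v` that occurs `p` times around it, every other color
except `f v` occurring once. The map `v ↦ (f v, h v)` is then a covering of `L*(K_{p+2})`
(`IsStarColoring.exists_covering`), onto because `L*(K_{p+2})` is connected. The fiber matrix of a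
covering intertwines the adjacency matrices, which gives divisibility over `ℤ`.

The spectrum of `L*(K_{p+2})` comes from splitting the darts into an orientation and its reverse:
the two resulting blocks are, up to shift and sign, Gram matrices of unsigned and signed incidence
matrices. -/

namespace Matrix

/-! ### Characteristic polynomials under intertwining and block symmetry -/

open Polynomial

variable {R m n : Type*} [CommRing R] [Fintype m] [DecidableEq m] [Fintype n] [DecidableEq n]

/-- If `P` intertwines `A` and `B` and has a left inverse, then the characteristic polynomial of
`B` divides that of `A` up to a power of `X`. -/
theorem charpoly_dvd_X_pow_mul_charpoly_of_intertwine {A : Matrix m m R} {B : Matrix n n R}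
    {P : Matrix m n R} {L : Matrix n m R} (hLP : L * P = 1) (h : A * P = P * B) :
    B.charpoly ∣ X ^ Fintype.card n * A.charpoly := by
  -- `W` kills the image of `P`, so `(X - W)(X - P B L) = X (X - A)`; determinants then give the
  -- claim.
  set W : Matrix m m R := A * (1 - P * L) with hW
  have hAsum : A = W + P * (B * L) := by
    rw [hW, mul_sub, mul_one, ← Matrix.mul_assoc, ← Matrix.mul_assoc, h, sub_add_cancel]
  have hWU : W * (P * (B * L)) = 0 := by
    have : (1 - P * L) * P = 0 := by
      rw [Matrix.sub_mul, Matrix.one_mul, Matrix.mul_assoc, hLP, Matrix.mul_one, sub_self]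
    rw [hW, ← Matrix.mul_assoc, Matrix.mul_assoc A, this, Matrix.mul_zero, Matrix.zero_mul]
  have hprod : W.charmatrix * (P * (B * L)).charmatrix = (scalar m (X : R[X])) * A.charmatrix := by
    have hWU' : C.mapMatrix W * C.mapMatrix (P * (B * L)) = 0 := by
      rw [← map_mul, hWU, map_zero]
    have hc : C.mapMatrix W * scalar m (X : R[X]) = scalar m (X : R[X]) * C.mapMatrix W :=
      ((scalar_commute (X : R[X]) (fun _ => Commute.all _ _) _).eq).symm
    have hA : C.mapMatrix A = C.mapMatrix W + C.mapMatrix (P * (B * L)) := by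
      rw [← map_add, ← hAsum]
    rw [charmatrix, charmatrix, charmatrix, hA, sub_mul, mul_sub, mul_sub,
      mul_sub, hWU', hc, mul_add]
    abel
  have hdet : W.charpoly * (P * (B * L)).charpoly = X ^ Fintype.card m * A.charpoly := by
    rw [charpoly, charpoly, ← det_mul, hprod, det_mul]
    simp [charpoly]
  have hU : X ^ Fintype.card n * (P * (B * L)).charpoly = X ^ Fintype.card m * B.charpoly := by
    rw [charpoly_mul_comm', Matrix.mul_assoc, hLP, Matrix.mul_one]
  refine ⟨W.charpoly, (isRegular_X_pow (Fintype.card m)).left.eq_iff.mp ?_⟩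
  calc X ^ Fintype.card m * (X ^ Fintype.card n * A.charpoly)
      = W.charpoly * (X ^ Fintype.card n * (P * (B * L)).charpoly) := by
        linear_combination -X ^ Fintype.card n * hdet
    _ = X ^ Fintype.card m * (B.charpoly * W.charpoly) := by rw [hU]; ring

/-- If `P` intertwines `A` and `B` and has a left inverse, then the characteristic polynomial of
`B` divides that of `A`. -/
theorem charpoly_dvd_charpoly_of_intertwine {A : Matrix m m R} {B : Matrix n n R}
    {P : Matrix m n R} {L : Matrix n m R} (hLP : L * P = 1) (h : A * P = P * B) :
    B.charpoly ∣ A.charpoly := by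
  have h₀ := charpoly_dvd_X_pow_mul_charpoly_of_intertwine hLP h
  -- Shifting both matrices by `1` replaces the spurious `X ^ n` by the coprime `(X - 1) ^ n`, so a
  -- Bézout combination removes it.
  have h₁ : B.charpoly ∣ (X - 1) ^ Fintype.card n * A.charpoly := by
    have hs : (A - scalar m 1) * P = P * (B - scalar n 1) := by
      simp [Matrix.sub_mul, Matrix.mul_sub, h]
    obtain ⟨c, hc⟩ := charpoly_dvd_X_pow_mul_charpoly_of_intertwine hLP hs
    refine ⟨c.comp (X - 1), ?_⟩
    have := congrArg (fun q : R[X] => q.comp (X - 1)) hc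
    rw [charpoly_sub_scalar, charpoly_sub_scalar] at this
    simpa [comp_assoc] using this
  have hcop : IsCoprime ((X : R[X]) ^ Fintype.card n) ((X - 1) ^ Fintype.card n) :=
    IsCoprime.pow ⟨1, -1, by ring⟩
  obtain ⟨a, b, hab⟩ := hcop
  have : A.charpoly = a * (X ^ Fintype.card n * A.charpoly) +
      b * ((X - 1) ^ Fintype.card n * A.charpoly) := by
    linear_combination -A.charpoly * hab
  rw [this]
  exact dvd_add (h₀.mul_left a) (h₁.mul_left b)

/-- Conjugation by a unipotent block matrix makes it block triangular, so `2` need not be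
invertible. -/
theorem charpoly_fromBlocks_swap (M N : Matrix n n R) :
    (fromBlocks M N N M).charpoly = (M + N).charpoly * (M - N).charpoly := by
  have h₁ : fromBlocks M N N M = fromBlocks 1 0 1 1 *
      (fromBlocks (M + N) N 0 (M - N) * fromBlocks 1 0 (-1) 1) := by
    simp [fromBlocks_multiply]
  have h₂ : (fromBlocks 1 0 (-1) 1 : Matrix (n ⊕ n) (n ⊕ n) R) * fromBlocks 1 0 1 1 = 1 := by
    simp [fromBlocks_multiply]
  rw [h₁, charpoly_mul_comm, mul_assoc, h₂, mul_one, charpoly_fromBlocks_zero₂₁]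

theorem charpoly_add_scalar (M : Matrix n n R) (μ : R) :
    (M + scalar n μ).charpoly = M.charpoly.comp (X - C μ) := by
  have := charpoly_sub_scalar M (-μ)
  simpa [sub_eq_add_neg] using this

/-- The characteristic polynomial of `a I + b J`, where `J` is the all-ones matrix. -/
theorem charpoly_scalar_add_const [Nonempty n] (a b : R) :
    ((of fun _ _ => b) + scalar n a).charpoly =
      (X - C a) ^ (Fintype.card n - 1) * (X - C (a + Fintype.card n * b)) := by
  have h : (of fun _ _ => b : Matrix n n R) = vecMulVec (fun _ => b) (fun _ => 1) := by
    ext i j; simp [vecMulVec_apply]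
  have hc : Fintype.card n = (Fintype.card n - 1) + 1 :=
    (Nat.sub_add_cancel Fintype.card_pos).symm
  rw [charpoly_add_scalar, h, charpoly_vecMulVec]
  have hd : ((fun _ : n => b) ⬝ᵥ fun _ => 1) = Fintype.card n * b := by
    simp [dotProduct]
  have : (X ^ Fintype.card n : R[X]) = X ^ (Fintype.card n - 1) * X := by
    rw [← pow_succ, ← hc]
  rw [hd, this, smul_eq_C_mul]
  simp
  ring

end Matrix

/-! ### The spectrum of `L*(K_{p+2})` -/

namespace SimpleGraph

open Polynomial Matrix

variable {α : Type*}

theorem lineGraphStar_adj {V : Type*} {G : SimpleGraph V} {a b : G.Dart} :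
    G.lineGraphStar.Adj a b ↔
      (a.snd = b.fst ∧ a.fst ≠ b.snd) ∨ (b.snd = a.fst ∧ b.fst ≠ a.snd) := by
  change (a ≠ b ∧ ((a.snd = b.fst ∧ a.fst ≠ b.snd) ∨ (b.snd = a.fst ∧ b.fst ≠ a.snd))) ↔ _
  refine and_iff_right_of_imp ?_
  rintro h rfl
  rcases h with h | h <;> exact absurd h.1 a.snd_ne_fst

variable [DecidableEq α]

/-- Away from reversed pairs, `L*(K_α)` is described by coincidences of heads and tails. -/
theorem lineGraphStar_top_adjMatrix_apply (a b : (⊤ : SimpleGraph α).Dart) :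
    (⊤ : SimpleGraph α).lineGraphStar.adjMatrix ℤ a b =
      (if a.snd = b.fst then 1 else 0) + (if a.fst = b.snd then 1 else 0) -
        2 * (if a.fst = b.snd ∧ a.snd = b.fst then 1 else 0) := by
  have ha := a.fst_ne_snd
  have hb := b.fst_ne_snd
  simp only [adjMatrix_apply, lineGraphStar_adj]
  by_cases h₁ : a.snd = b.fst <;> by_cases h₂ : a.fst = b.snd <;>
    simp [h₁, h₂, eq_comm]
  all_goals grind

/-- The darts of the complete graph which increase with respect to a numbering of the vertices. -/
abbrev IncreasingDart (o : α → ℕ) : Type _ :=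
  {d : (⊤ : SimpleGraph α).Dart // o d.fst < o d.snd}

/-- Every dart of the complete graph is increasing or the reverse of an increasing dart. -/
def sumIncreasingDartEquiv (o : α → ℕ) (ho : Function.Injective o) :
    IncreasingDart o ⊕ IncreasingDart o ≃ (⊤ : SimpleGraph α).Dart where
  toFun := Sum.elim (fun e => e.1) (fun e => e.1.symm)
  invFun d := if h : o d.fst < o d.snd then .inl ⟨d, h⟩ else
    .inr ⟨d.symm, lt_of_le_of_ne (not_lt.mp h) fun h' => d.snd_ne_fst (ho h')⟩
  left_inv := by
    rintro (e | e)
    · simp [e.2]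
    · simp [e.2.le]
  right_inv d := by
    by_cases h : o d.fst < o d.snd <;> simp [h]

variable [Fintype α]

/-- The unsigned incidence matrix of the increasing darts. -/
def unsignedIncidence (o : α → ℕ) : Matrix (IncreasingDart o) α ℤ :=
  of fun e a => (if e.1.fst = a then 1 else 0) + (if e.1.snd = a then 1 else 0)

/-- The signed incidence matrix of the increasing darts. -/
def signedIncidence (o : α → ℕ) : Matrix (IncreasingDart o) α ℤ :=
  of fun e a => (if e.1.fst = a then 1 else 0) - (if e.1.snd = a then 1 else 0)

theorem sum_dart_top (F : α → α → ℤ) :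
    ∑ d : (⊤ : SimpleGraph α).Dart, F d.fst d.snd = ∑ u, ∑ v, if u = v then 0 else F u v := by
  rw [← Fintype.sum_prod_type' (f := fun u v => if u = v then 0 else F u v)]
  rw [← Finset.sum_filter_ne_zero]
  symm
  rw [← Finset.sum_filter_ne_zero]
  refine (Finset.sum_bij (fun d _ => d.toProd) ?_ ?_ ?_ ?_).symm
  · intro d hd
    simpa [d.fst_ne_snd] using hd
  · intro d _ d' _ h
    exact Dart.ext _ _ h
  · rintro ⟨u, v⟩ h
    have huv : u ≠ v := by rintro rfl; simp at h
    refine ⟨⟨(u, v), huv⟩, ?_, rfl⟩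
    simpa [huv] using h
  · intro d _
    simp [d.fst_ne_snd]

/-- Reversal pairs the increasing darts with the others, and a symmetric `F` does not see it. -/
theorem two_mul_sum_increasingDart {o : α → ℕ} (ho : Function.Injective o) {F : α → α → ℤ}
    (hF : ∀ u v, F u v = F v u) :
    2 * ∑ e : IncreasingDart o, F e.1.fst e.1.snd = ∑ u, ∑ v, if u = v then 0 else F u v := by
  rw [← sum_dart_top, ← (sumIncreasingDartEquiv o ho).sum_comp, Fintype.sum_sum_type]
  simp only [sumIncreasingDartEquiv, Equiv.coe_fn_mk, Sum.elim_inl, Sum.elim_inr]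
  rw [two_mul]
  congr 1
  exact Finset.sum_congr rfl fun e _ => hF _ _

theorem unsignedIncidence_transpose_mul_self {o : α → ℕ} (ho : Function.Injective o) :
    (unsignedIncidence o)ᵀ * unsignedIncidence o =
      (of fun _ _ => 1) + scalar α ((Fintype.card α : ℤ) - 2) := by
  ext a b
  have h := two_mul_sum_increasingDart ho
    (F := fun u v => ((if u = a then 1 else 0) + (if v = a then 1 else 0)) *
      ((if u = b then 1 else 0) + (if v = b then 1 else 0))) (fun u v => by ring)
  -- The last term removes the diagonal, where all four products agree; in the signed case they
  -- cancel by themselves.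
  have h' : ∀ u v : α, (if u = v then (0 : ℤ) else
      ((if u = a then 1 else 0) + (if v = a then 1 else 0)) *
      ((if u = b then 1 else 0) + (if v = b then 1 else 0))) =
      (if u = a then (if u = b then 1 else 0) else 0) +
      (if v = a then (if v = b then 1 else 0) else 0) +
      (if u = a then (if v = b then 1 else 0) else 0) +
      (if v = a then (if u = b then 1 else 0) else 0) -
      4 * (if u = v then (if u = a then (if u = b then 1 else 0) else 0) else 0) := by
    intro u v
    split_ifs <;> simp_all
  simp only [h', Finset.sum_add_distrib, Finset.sum_sub_distrib, ← Finset.mul_sum] at h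
  simp [Finset.sum_ite_irrel] at h
  simp only [mul_apply, transpose_apply, unsignedIncidence, of_apply, Matrix.add_apply, scalar_apply,
    diagonal_apply]
  by_cases hab : a = b
  · subst hab; simp at h ⊢; linarith
  · simp [hab] at h ⊢; linarith

theorem signedIncidence_transpose_mul_self {o : α → ℕ} (ho : Function.Injective o) :
    (signedIncidence o)ᵀ * signedIncidence o =
      (of fun _ _ => -1) + scalar α (Fintype.card α : ℤ) := by
  ext a b
  have h := two_mul_sum_increasingDart ho
    (F := fun u v => ((if u = a then 1 else 0) - (if v = a then 1 else 0)) *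
      ((if u = b then 1 else 0) - (if v = b then 1 else 0))) (fun u v => by ring)
  have h' : ∀ u v : α, (if u = v then (0 : ℤ) else
      ((if u = a then 1 else 0) - (if v = a then 1 else 0)) *
      ((if u = b then 1 else 0) - (if v = b then 1 else 0))) =
      (if u = a then (if u = b then 1 else 0) else 0) +
      (if v = a then (if v = b then 1 else 0) else 0) -
      (if u = a then (if v = b then 1 else 0) else 0) -
      (if v = a then (if u = b then 1 else 0) else 0) := by
    intro u v
    split_ifs <;> simp_all
  simp only [h', Finset.sum_add_distrib, Finset.sum_sub_distrib] at h
  simp [Finset.sum_ite_irrel] at h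
  simp only [mul_apply, transpose_apply, signedIncidence, of_apply, Matrix.add_apply, scalar_apply,
    diagonal_apply]
  by_cases hab : a = b
  · subst hab; simp at h ⊢; linarith
  · simp [hab] at h ⊢; linarith

theorem card_increasingDart {o : α → ℕ} (ho : Function.Injective o) :
    2 * Fintype.card (IncreasingDart o) = Fintype.card α * (Fintype.card α - 1) := by
  have h := Fintype.card_congr (sumIncreasingDartEquiv o ho)
  rw [Fintype.card_sum, dart_card_eq_sum_degrees] at h
  simp only [complete_graph_degree, Finset.sum_const, Finset.card_univ, smul_eq_mul] at h
  omega

/-- In terms of increasing darts and their reverses, the adjacency matrix of `L*(K_α)` is a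
symmetric two-by-two block matrix. -/
theorem exists_blocks_lineGraphStar_top {o : α → ℕ} (ho : Function.Injective o) :
    ∃ M N : Matrix (IncreasingDart o) (IncreasingDart o) ℤ,
      ((⊤ : SimpleGraph α).lineGraphStar.adjMatrix ℤ).charpoly = (fromBlocks M N N M).charpoly ∧
      M + N = unsignedIncidence o * (unsignedIncidence o)ᵀ - scalar _ 2 ∧
      M - N = -signedIncidence o * (signedIncidence o)ᵀ + scalar _ 2 := by
  refine ⟨of fun a b => (if a.1.snd = b.1.fst then 1 else 0) +
      (if a.1.fst = b.1.snd then 1 else 0),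
    of fun a b => (if a.1.fst = b.1.fst then 1 else 0) + (if a.1.snd = b.1.snd then 1 else 0) -
      2 * (if a = b then 1 else 0), ?_, ?_, ?_⟩
  · rw [← charpoly_reindex (sumIncreasingDartEquiv o ho).symm]
    congr 1
    have hne : ∀ a b : IncreasingDart o, ¬ (a.1.fst = b.1.snd ∧ a.1.snd = b.1.fst) := by
      rintro a b ⟨h₁, h₂⟩
      have ha := a.2
      have hb := b.2
      rw [h₁, h₂] at ha
      omega
    have heq : ∀ a b : IncreasingDart o, a = b ↔ (a.1.fst = b.1.fst ∧ a.1.snd = b.1.snd) := by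
      intro a b
      rw [Subtype.ext_iff, Dart.ext_iff, Prod.ext_iff]
    ext (a | a) (b | b) <;>
      rw [reindex_apply, submatrix_apply, lineGraphStar_top_adjMatrix_apply]
    · have := hne a b
      simp [sumIncreasingDartEquiv]
      grind
    · simp [sumIncreasingDartEquiv, heq]
      ring
    · simp [sumIncreasingDartEquiv, heq, and_comm]
    · have := hne a b
      simp [sumIncreasingDartEquiv]
      grind
  · ext a b
    simp only [Matrix.sub_apply, scalar_apply, diagonal_apply, unsignedIncidence, mul_apply,
      of_apply, transpose_apply, Matrix.add_apply, add_mul, Finset.sum_add_distrib, ite_mul,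
      one_mul, zero_mul, Finset.sum_ite_eq, Finset.mem_univ, if_true]
    simp only [eq_comm, mul_ite, mul_one, mul_zero]
    ring
  · ext a b
    simp only [Matrix.sub_apply, scalar_apply, diagonal_apply, signedIncidence, mul_apply,
      of_apply, transpose_apply, Matrix.add_apply, Matrix.neg_apply, neg_mul, sub_mul,
      Finset.sum_neg_distrib, Finset.sum_sub_distrib, ite_mul, one_mul, zero_mul,
      Finset.sum_ite_eq, Finset.mem_univ, if_true]
    simp only [eq_comm, mul_ite, mul_one, mul_zero]
    ring

theorem charpoly_lineGraphStar_top {p : ℕ} (hp : 2 ≤ p) (hα : Fintype.card α = p + 2) :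
    ((⊤ : SimpleGraph α).lineGraphStar.adjMatrix ℤ).charpoly =
      (X - C (2 * (p : ℤ))) * (X + C 2) ^ ((p - 1) * (p + 2) / 2) *
        (X - C 2) ^ (p * (p + 1) / 2) * (X - C (p : ℤ) + C 2) ^ (p + 1) *
        (X + C (p : ℤ)) ^ (p + 1) := by
  have : Nonempty α := Fintype.card_pos_iff.mp (by omega)
  obtain ⟨o, ho⟩ : ∃ o : α → ℕ, Function.Injective o :=
    ⟨fun a => Fintype.equivFin α a, Fin.val_injective.comp (Fintype.equivFin α).injective⟩
  obtain ⟨M, N, h, hadd, hsub⟩ := exists_blocks_lineGraphStar_top ho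
  have hE := card_increasingDart ho
  obtain ⟨k, rfl⟩ : ∃ k, p = k + 2 := ⟨p - 2, by omega⟩
  rw [hα] at hE
  have h₁ : Fintype.card (IncreasingDart o) - Fintype.card α =
      (k + 2 - 1) * (k + 2 + 2) / 2 := by
    rw [hα]
    have : (k + 2 + 2) * (k + 2 + 2 - 1) = (k + 2 - 1) * (k + 2 + 2) + 2 * (k + 4) := by
      simp only [Nat.add_succ_sub_one]; ring
    omega
  have h₂ : Fintype.card (IncreasingDart o) - Fintype.card α + 1 =
      (k + 2) * (k + 2 + 1) / 2 := by
    rw [hα]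
    have : (k + 2 + 2) * (k + 2 + 2 - 1) = (k + 2) * (k + 2 + 1) + 2 * (k + 3) := by
      simp only [Nat.add_succ_sub_one]; ring
    have : (k + 2) * (k + 2 + 1) = k * k + 5 * k + 6 := by ring
    omega
  have hle : Fintype.card α ≤ Fintype.card (IncreasingDart o) := by
    have : (k + 2 + 2) * (k + 2 + 2 - 1) = (k + 2) * (k + 2 + 1) + 2 * (k + 3) := by
      simp only [Nat.add_succ_sub_one]; ring
    have : (k + 2) * (k + 2 + 1) = k * k + 5 * k + 6 := by ring
    omega
  have hneg : (signedIncidence o)ᵀ * -signedIncidence o =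
      (of fun _ _ => 1) + scalar α (-(Fintype.card α : ℤ)) := by
    rw [Matrix.mul_neg, signedIncidence_transpose_mul_self ho]
    ext a b
    simp only [Matrix.neg_apply, Matrix.add_apply, of_apply, scalar_apply, diagonal_apply]
    split_ifs <;> ring
  -- Passing from `U Uᵀ` to `Uᵀ U` leaves a power of `X`, the source of the large multiplicities.
  -- The signed Gram matrix is singular, which adds one more factor `X - 2`.
  rw [h, charpoly_fromBlocks_swap, hadd, hsub, charpoly_sub_scalar, charpoly_add_scalar,
    charpoly_mul_comm_of_le _ _ hle, charpoly_mul_comm_of_le _ _ hle,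
    unsignedIncidence_transpose_mul_self ho, hneg, charpoly_scalar_add_const,
    charpoly_scalar_add_const, ← h₁, ← h₂, pow_succ (X - C 2), hα]
  simp
  ring

end SimpleGraph

/-! ### Star colorings: the double count and its equality case -/

namespace SimpleGraph

theorem StarFree.card_lt {V : Type*} {G : SimpleGraph V} {r : ℕ} (h : G.StarFree r) {v : V}
    {s : Finset V} (hs : ∀ x ∈ s, G.Adj v x) (hind : ∀ x ∈ s, ∀ y ∈ s, ¬ G.Adj x y) :
    s.card < r := by
  by_contra! hr
  obtain ⟨t, hts, htc⟩ := Finset.exists_subset_card_eq hr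
  let e : Fin r ≃ t := (t.equivFinOfCardEq htc).symm
  have hm : ∀ i, (e i : V) ∈ s := fun i => hts (e i).2
  refine h ⟨⟨⟨Sum.elim (fun _ => v) (fun i => (e i : V)), ?_⟩, ?_⟩⟩
  · rintro (a | a) (b | b) hab
    · simp [Subsingleton.elim a b]
    · have hab' : v = (e b : V) := hab
      exact absurd (hs _ (hm b)) (hab' ▸ G.irrefl)
    · have hab' : (e a : V) = v := hab
      exact absurd (hs _ (hm a)) (hab' ▸ G.irrefl)
    · have hab' : (e a : V) = e b := hab
      simpa [Subtype.ext_iff] using hab'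
  · rintro (a | a) (b | b)
    · exact iff_of_false (G.irrefl (v := v)) (by simp)
    · exact iff_of_true (hs _ (hm b)) (by simp)
    · exact iff_of_true (hs _ (hm a)).symm (by simp)
    · exact iff_of_false (hind _ (hm a) _ (hm b)) (by simp)

variable {V : Type*} [Fintype V] {G : SimpleGraph V} [DecidableRel G.Adj]
  {p : ℕ} {f : V → ZMod (p + 2)}

/-- The neighbors of `v` that have color `j`. -/
def colorNeighbors {C : Type*} [DecidableEq C] (G : SimpleGraph V) [DecidableRel G.Adj]
    (f : V → C) (v : V) (j : C) : Finset V :=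
  (G.neighborFinset v).filter (fun w => f w = j)

section

variable {C : Type*} [DecidableEq C] {g : V → C}

theorem mem_colorNeighbors {v w : V} {j : C} :
    w ∈ G.colorNeighbors g v j ↔ G.Adj v w ∧ g w = j := by
  simp [colorNeighbors]

theorem card_colorNeighbors_pos {v w : V} (h : G.Adj v w) :
    0 < (G.colorNeighbors g v (g w)).card :=
  Finset.card_pos.mpr ⟨w, mem_colorNeighbors.mpr ⟨h, rfl⟩⟩

/-- Each color seen from `v` contributes one to the sum of the reciprocals of the color
multiplicities over the neighbors of `v`. -/
theorem sum_inv_card_colorNeighbors [Fintype C] (v : V) (hv : ∀ w, G.Adj v w → g v ≠ g w) :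
    ∑ w ∈ G.neighborFinset v, ((G.colorNeighbors g v (g w)).card : ℚ)⁻¹ =
      ∑ j ∈ Finset.univ.erase (g v), if (G.colorNeighbors g v j).card = 0 then 0 else 1 := by
  rw [← Finset.sum_fiberwise_of_maps_to (t := Finset.univ.erase (g v)) (g := g)
    (fun w hw => by simpa using (hv w (by simpa using hw)).symm)]
  refine Finset.sum_congr rfl fun j _ => ?_
  have : ∀ w ∈ (G.neighborFinset v).filter (fun w => g w = j),
      ((G.colorNeighbors g v (g w)).card : ℚ)⁻¹ = ((G.colorNeighbors g v j).card : ℚ)⁻¹ := by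
    intro w hw
    rw [(Finset.mem_filter.mp hw).2]
  rw [Finset.sum_congr rfl this, Finset.sum_const, nsmul_eq_mul]
  change ((G.colorNeighbors g v j).card : ℚ) * _ = _
  split_ifs with h
  · simp [h]
  · exact mul_inv_cancel₀ (by exact_mod_cast h)

theorem sum_card_colorNeighbors [Fintype C] (v : V) (hv : ∀ w, G.Adj v w → g v ≠ g w) :
    ∑ j ∈ Finset.univ.erase (g v), (G.colorNeighbors g v j).card = G.degree v := by
  rw [← card_neighborFinset_eq_degree]
  exact (Finset.card_eq_sum_card_fiberwise
    (fun w hw => by simpa using (hv w (by simpa using hw)).symm)).symm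

end

/-- A color class is independent, so `p + 1` neighbors of one color would span an induced star. -/
theorem IsStarColoring.card_colorNeighbors_le (hf : G.IsStarColoring (p + 2) f)
    (hG : G.StarFree (p + 1)) (v : V) (j : ZMod (p + 2)) :
    (G.colorNeighbors f v j).card ≤ p := by
  refine Nat.lt_succ_iff.mp (hG.card_lt (v := v) (fun x hx => (mem_colorNeighbors.mp hx).1) ?_)
  intro x hx y hy hxy
  exact hf.proper x y hxy
    ((mem_colorNeighbors.mp hx).2.trans (mem_colorNeighbors.mp hy).2.symm)

/-- Two adjacent vertices cannot both see the color of the other one twice. -/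
theorem IsStarColoring.card_colorNeighbors_eq_one (hf : G.IsStarColoring (p + 2) f) {u v : V}
    (h : G.Adj u v) :
    (G.colorNeighbors f u (f v)).card = 1 ∨ (G.colorNeighbors f v (f u)).card = 1 := by
  have hu := card_colorNeighbors_pos (g := f) h
  have hv := card_colorNeighbors_pos (g := f) h.symm
  by_contra! hne
  -- Second witnesses `x`, `y` on both sides give the forbidden path `x, u, v, y`.
  obtain ⟨x, hx, hxv⟩ := Finset.exists_mem_ne (s := G.colorNeighbors f u (f v)) (by omega) v
  obtain ⟨y, hy, hyu⟩ := Finset.exists_mem_ne (s := G.colorNeighbors f v (f u)) (by omega) u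
  rw [mem_colorNeighbors] at hx hy
  refine hf.no_bicolored_path x u v y hx.1.symm h hy.1 ?_ ⟨hx.2, hy.2.symm⟩
  have hxy : x ≠ y := by
    rintro rfl
    exact hf.proper u v h (hy.2.symm.trans hx.2)
  simp [hxy, hxv, hx.1.ne', h.ne, hyu.symm, hy.1.ne]

/-- In the extremal case every color other than that of `v` occurs around `v`, and each edge joins
the center of a bicolored star with `p` leaves to one of its leaves. -/
theorem IsStarColoring.extremal (hp : 2 ≤ p) (hf : G.IsStarColoring (p + 2) f)
    (hG : G.StarFree (p + 1)) (hreg : G.IsRegularOfDegree (2 * p)) :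
    (∀ v j, j ≠ f v → 0 < (G.colorNeighbors f v j).card) ∧
    (∀ u v, G.Adj u v →
      ((G.colorNeighbors f u (f v)).card = p ∧ (G.colorNeighbors f v (f u)).card = 1) ∨
      ((G.colorNeighbors f u (f v)).card = 1 ∧ (G.colorNeighbors f v (f u)).card = p)) := by
  have hp0 : (0 : ℚ) < p := by exact_mod_cast (by omega : 0 < p)
  let c : V → V → ℚ := fun u v => ((G.colorNeighbors f u (f v)).card : ℚ)⁻¹
  let F : V → V → ℚ := fun u v => if G.Adj u v then c u v else 0
  have hrow : ∀ v, ∑ w, F v w =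
      ∑ j ∈ Finset.univ.erase (f v), if (G.colorNeighbors f v j).card = 0 then 0 else 1 := by
    intro v
    rw [← sum_inv_card_colorNeighbors v (hf.proper v), ← Finset.sum_filter,
      neighborFinset_eq_filter]
  have hcard : ∀ v, ∑ j ∈ Finset.univ.erase (f v), (1 : ℚ) = p + 1 := by
    intro v
    simp [Finset.card_erase_of_mem, ZMod.card]
  have hrow_le : ∀ v, ∑ w, F v w ≤ p + 1 := by
    intro v
    rw [hrow, ← hcard v]
    refine Finset.sum_le_sum fun j _ => ?_
    split_ifs <;> norm_num
  have hinv : ∀ u v, G.Adj u v → (p : ℚ)⁻¹ ≤ c u v := by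
    intro u v h
    have h0 := card_colorNeighbors_pos (g := f) h
    exact inv_anti₀ (by exact_mod_cast h0)
      (by exact_mod_cast hf.card_colorNeighbors_le hG u (f v))
  have hedge : ∀ u v, (if G.Adj u v then 1 + (p : ℚ)⁻¹ else 0) ≤ F u v + F v u := by
    intro u v
    by_cases h : G.Adj u v
    · simp only [F, h, h.symm, if_true]
      rcases hf.card_colorNeighbors_eq_one h with h1 | h1
      · have := hinv v u h.symm
        simp only [c, h1] at this ⊢
        simpa using this
      · have := hinv u v h
        simp only [c, h1] at this ⊢
        rw [add_comm]
        simpa using this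
    · simp [F, h, G.adj_comm v u]
  -- Since `2p (1 + 1/p) = 2 (p + 1)`, the edgewise lower bound meets twice the rowwise upper bound.
  have hlow : ∑ u, ∑ v, (if G.Adj u v then 1 + (p : ℚ)⁻¹ else 0) =
      2 * ∑ u : V, ((p : ℚ) + 1) := by
    rw [Finset.mul_sum]
    refine Finset.sum_congr rfl fun u _ => ?_
    rw [← Finset.sum_filter, Finset.sum_const, ← neighborFinset_eq_filter,
      card_neighborFinset_eq_degree, hreg u, nsmul_eq_mul]
    push_cast
    field_simp
  have hsymm : ∑ u, ∑ v, (F u v + F v u) = 2 * ∑ u, ∑ v, F u v := by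
    simp only [Finset.sum_add_distrib]
    rw [Finset.sum_comm (f := fun u v => F v u)]
    ring
  have hle₁ : ∑ u, ∑ v, (if G.Adj u v then 1 + (p : ℚ)⁻¹ else 0) ≤
      ∑ u, ∑ v, (F u v + F v u) :=
    Finset.sum_le_sum fun u _ => Finset.sum_le_sum fun v _ => hedge u v
  have hle₂ : ∑ u, ∑ v, F u v ≤ ∑ u : V, ((p : ℚ) + 1) :=
    Finset.sum_le_sum fun u _ => hrow_le u
  have heq₂ : ∑ u, ∑ v, F u v = ∑ u : V, ((p : ℚ) + 1) := by linarith
  have heq₁ : ∑ u, ∑ v, (if G.Adj u v then 1 + (p : ℚ)⁻¹ else 0) =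
      ∑ u, ∑ v, (F u v + F v u) := by linarith
  constructor
  · intro v j hj
    have h1 := (Finset.sum_eq_sum_iff_of_le fun u _ => hrow_le u).mp heq₂ v (Finset.mem_univ v)
    rw [hrow, ← hcard v] at h1
    have h2 := (Finset.sum_eq_sum_iff_of_le (fun j _ => by split_ifs <;> norm_num)).mp h1 j
      (by simpa using hj)
    by_contra h0
    simp [show (G.colorNeighbors f v j).card = 0 by omega] at h2
  · intro u v h
    have h1 := (Finset.sum_eq_sum_iff_of_le
      fun u _ => Finset.sum_le_sum fun v _ => hedge u v).mp heq₁ u (Finset.mem_univ u)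
    have h2 := (Finset.sum_eq_sum_iff_of_le fun v _ => hedge u v).mp h1 v (Finset.mem_univ v)
    simp only [F, h, h.symm, if_true, c] at h2
    rcases hf.card_colorNeighbors_eq_one h with h3 | h3
    · right
      refine ⟨h3, ?_⟩
      rw [h3] at h2
      simpa using h2.symm
    · left
      refine ⟨?_, h3⟩
      rw [h3, add_comm] at h2
      simpa using h2.symm

/-- In the extremal case each vertex is the center of exactly one bicolored star. -/
theorem IsStarColoring.exists_center_color (hp : 2 ≤ p) (hf : G.IsStarColoring (p + 2) f)
    (hG : G.StarFree (p + 1)) (hreg : G.IsRegularOfDegree (2 * p)) (v : V) :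
    ∃ k, k ≠ f v ∧ (G.colorNeighbors f v k).card = p ∧
      ∀ j, j ≠ f v → j ≠ k → (G.colorNeighbors f v j).card = 1 := by
  obtain ⟨hpos, hedge⟩ := hf.extremal hp hG hreg
  have hdich : ∀ j, j ≠ f v →
      (G.colorNeighbors f v j).card = p ∨ (G.colorNeighbors f v j).card = 1 := by
    intro j hj
    obtain ⟨w, hw⟩ := Finset.card_pos.mp (hpos v j hj)
    obtain ⟨hvw, rfl⟩ := mem_colorNeighbors.mp hw
    rcases hedge v w hvw with h | h
    · exact Or.inl h.1
    · exact Or.inr h.1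
  have hsum := sum_card_colorNeighbors v (hf.proper v)
  rw [hreg v] at hsum
  -- Multiplicities are `1` or `p`, so `2p = (p + 1) + (p - 1) m`, with `m` the number of colors of
  -- multiplicity `p`; `p ≥ 2` forces `m = 1`.
  have hsplit : ∑ j ∈ Finset.univ.erase (f v), (G.colorNeighbors f v j).card =
      ∑ j ∈ Finset.univ.erase (f v),
        (1 + (p - 1) * if (G.colorNeighbors f v j).card = p then 1 else 0) := by
    refine Finset.sum_congr rfl fun j hj => ?_
    rcases hdich j (Finset.ne_of_mem_erase hj) with h | h
    · rw [h]; simp; omega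
    · rw [h, if_neg (by omega), mul_zero, add_zero]
  rw [hsplit, Finset.sum_add_distrib, ← Finset.mul_sum, ← Finset.card_filter] at hsum
  simp only [Finset.sum_const, Finset.card_erase_of_mem (Finset.mem_univ _), Finset.card_univ,
    ZMod.card, smul_eq_mul, mul_one] at hsum
  have hone : ((Finset.univ.erase (f v)).filter
      fun j => (G.colorNeighbors f v j).card = p).card = 1 := by
    have : (p - 1) * ((Finset.univ.erase (f v)).filter
      fun j => (G.colorNeighbors f v j).card = p).card = (p - 1) * 1 := by omega
    exact Nat.eq_of_mul_eq_mul_left (by omega) this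
  obtain ⟨k, hk⟩ := Finset.card_eq_one.mp hone
  have hmem : ∀ j, (j ≠ f v ∧ (G.colorNeighbors f v j).card = p) ↔ j = k := by
    intro j
    have := Finset.ext_iff.mp hk j
    simpa using this
  refine ⟨k, ((hmem k).mpr rfl).1, ((hmem k).mpr rfl).2, fun j hj hjk => ?_⟩
  exact (hdich j hj).resolve_left fun h => hjk ((hmem j).mp ⟨hj, h⟩)

/-! ### The covering map and divisibility -/

/-- In the extremal case, a star coloring yields a covering map onto `L*(K_{p+2})`. -/
theorem IsStarColoring.exists_covering (hp : 2 ≤ p) (hf : G.IsStarColoring (p + 2) f)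
    (hG : G.StarFree (p + 1)) (hreg : G.IsRegularOfDegree (2 * p)) :
    ∃ φ : V → (⊤ : SimpleGraph (ZMod (p + 2))).Dart,
      (∀ u v, G.Adj u v → (⊤ : SimpleGraph (ZMod (p + 2))).lineGraphStar.Adj (φ u) (φ v)) ∧
      ∀ v d, (⊤ : SimpleGraph (ZMod (p + 2))).lineGraphStar.Adj (φ v) d →
        ∃! w, G.Adj v w ∧ φ w = d := by
  classical
  obtain ⟨-, hedge⟩ := hf.extremal hp hG hreg
  choose h hne hcenter hleaf using hf.exists_center_color hp hG hreg
  have hout : ∀ u v, G.Adj u v → f v = h u → h v ≠ f u := by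
    intro u v huv e e'
    have h1 := hcenter u
    have h2 := hcenter v
    rw [← e] at h1
    rw [e'] at h2
    rcases hf.card_colorNeighbors_eq_one huv with h3 | h3 <;> omega
  have hin : ∀ u v, G.Adj u v → f v ≠ h u → h v = f u := by
    intro u v huv e
    by_contra e'
    have h1 := hleaf u (f v) (hf.proper u v huv).symm e
    have h2 := hleaf v (f u) (hf.proper u v huv) (Ne.symm e')
    rcases hedge u v huv with h3 | h3 <;> omega
  let φ : V → (⊤ : SimpleGraph (ZMod (p + 2))).Dart := fun v => ⟨(f v, h v), (hne v).symm⟩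
  have hφ : ∀ v d, φ v = d ↔ f v = d.fst ∧ h v = d.snd := by
    intro v d
    rw [Dart.ext_iff, Prod.ext_iff]
  have hexin : ∀ v k, k ≠ f v → k ≠ h v → ∃ w, G.Adj v w ∧ f w = k ∧ h w = f v := by
    intro v k hk hk'
    obtain ⟨w, hw⟩ := Finset.card_pos.mp (by rw [hleaf v k hk hk']; norm_num)
    obtain ⟨hvw, rfl⟩ := mem_colorNeighbors.mp hw
    exact ⟨w, hvw, rfl, hin v w hvw hk'⟩
  -- If no leaf of the star at `v` has center color `k`, the neighbor `y` of color `k` is adjacent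
  -- to none of the `p` leaves, and together they form an induced `K_{1,p+1}`.
  have hexout : ∀ v k, k ≠ f v → k ≠ h v → ∃ w ∈ G.colorNeighbors f v (h v), h w = k := by
    intro v k hk hk'
    obtain ⟨y, hvy, rfl, hy⟩ := hexin v k hk hk'
    by_contra! hno
    have hind : ∀ x ∈ G.colorNeighbors f v (h v), ¬ G.Adj y x := by
      intro x hx hxy
      refine hno x hx (hin y x hxy ?_)
      rw [hy, (mem_colorNeighbors.mp hx).2]
      exact hne v
    have hynot : y ∉ G.colorNeighbors f v (h v) :=
      fun hy' => hk' (mem_colorNeighbors.mp hy').2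
    have := hG.card_lt (v := v) (s := insert y (G.colorNeighbors f v (h v))) ?_ ?_
    · rw [Finset.card_insert_of_notMem hynot, hcenter] at this
      omega
    · intro x hx
      rcases Finset.mem_insert.mp hx with rfl | hx
      · exact hvy
      · exact (mem_colorNeighbors.mp hx).1
    · intro a ha b hb hab
      rw [Finset.mem_insert] at ha hb
      rcases ha with ha | ha <;> rcases hb with hb | hb
      · exact G.irrefl (ha ▸ hb ▸ hab)
      · exact hind b hb (ha ▸ hab)
      · exact hind a ha (hb ▸ hab.symm)
      · exact hf.proper a b hab
          ((mem_colorNeighbors.mp ha).2.trans (mem_colorNeighbors.mp hb).2.symm)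
  refine ⟨φ, ?_, ?_⟩
  · intro u v huv
    rw [lineGraphStar_adj]
    by_cases e : f v = h u
    · exact Or.inl ⟨e.symm, (hout u v huv e).symm⟩
    · exact Or.inr ⟨hin u v huv e, e⟩
  · intro v d hd
    have hdne := d.fst_ne_snd
    rcases lineGraphStar_adj.mp hd with ⟨h1, h2⟩ | ⟨h1, h2⟩
    · change h v = d.fst at h1
      change f v ≠ d.snd at h2
      -- `h` maps the `p` leaves onto the `p` colors other than `f v` and `h v`, so it is injective
      -- on them.
      have hinj : Set.InjOn h (G.colorNeighbors f v (h v)) := by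
        refine Finset.injOn_of_surjOn_of_card_le (t := (Finset.univ.erase (f v)).erase (h v))
          h ?_ ?_ ?_
        · intro w hw
          obtain ⟨hvw, hw⟩ := mem_colorNeighbors.mp hw
          have := hout v w hvw hw
          have := hne w
          simp_all
        · intro k hk
          have hk : k ≠ h v ∧ k ≠ f v := by simpa [and_comm] using hk
          obtain ⟨w, hw, e⟩ := hexout v k hk.2 hk.1
          exact ⟨w, hw, e⟩
        · rw [hcenter, Finset.card_erase_of_mem (by simpa using hne v),
            Finset.card_erase_of_mem (Finset.mem_univ _), Finset.card_univ, ZMod.card]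
          omega
      obtain ⟨w, hw, e⟩ := hexout v d.snd h2.symm (h1 ▸ hdne.symm)
      have hw' := mem_colorNeighbors.mp hw
      refine ⟨w, ⟨hw'.1, (hφ w d).mpr ⟨hw'.2.trans h1, e⟩⟩, ?_⟩
      rintro x ⟨hvx, hx⟩
      obtain ⟨hx1, hx2⟩ := (hφ x d).mp hx
      exact hinj (mem_colorNeighbors.mpr ⟨hvx, hx1.trans h1.symm⟩) hw (hx2.trans e.symm)
    · change d.snd = f v at h1
      change d.fst ≠ h v at h2
      have hdv : d.fst ≠ f v := h1 ▸ hdne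
      obtain ⟨w, hvw, e1, e2⟩ := hexin v d.fst hdv h2
      refine ⟨w, ⟨hvw, (hφ w d).mpr ⟨e1, e2.trans h1.symm⟩⟩, ?_⟩
      rintro x ⟨hvx, hx⟩
      obtain ⟨hx1, -⟩ := (hφ x d).mp hx
      exact Finset.card_le_one.mp (hleaf v d.fst hdv h2).le x
        (mem_colorNeighbors.mpr ⟨hvx, hx1⟩) w (mem_colorNeighbors.mpr ⟨hvw, e1⟩)

/-- A nonempty set of darts of a complete graph on at least four vertices that is closed under
adjacency in `L*` contains every dart. -/
theorem lineGraphStar_top_closed {α : Type*} [Fintype α] (hα : 4 ≤ Fintype.card α)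
    {S : Set (⊤ : SimpleGraph α).Dart} (hS : S.Nonempty)
    (hcl : ∀ a ∈ S, ∀ b, (⊤ : SimpleGraph α).lineGraphStar.Adj a b → b ∈ S) (d) : d ∈ S := by
  classical
  have havoid : ∀ a b c : α, ∃ k, k ≠ a ∧ k ≠ b ∧ k ≠ c := by
    intro a b c
    have : ({a, b, c} : Finset α).card < (Finset.univ : Finset α).card :=
      Finset.card_le_three.trans_lt (by rw [Finset.card_univ]; omega)
    obtain ⟨k, -, hk⟩ := Finset.exists_mem_notMem_of_card_lt_card this
    exact ⟨k, by simpa using hk⟩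
  let T : α → α → Prop := fun u v => ∃ h : u ≠ v, (⟨(u, v), h⟩ : (⊤ : SimpleGraph α).Dart) ∈ S
  have hfwd : ∀ u v w, T u v → w ≠ u → w ≠ v → T v w := fun u v w ⟨h, hT⟩ hwu hwv =>
    ⟨hwv.symm, hcl _ hT _ (lineGraphStar_adj.mpr (Or.inl ⟨rfl, hwu.symm⟩))⟩
  have hbwd : ∀ u v w, T u v → w ≠ u → w ≠ v → T w u := fun u v w ⟨h, hT⟩ hwu hwv =>
    ⟨hwu, hcl _ hT _ (lineGraphStar_adj.mpr (Or.inr ⟨rfl, hwv⟩))⟩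
  -- Step back to `(k, u)`, then forward to `(u, w)`; `k` must avoid three vertices, hence the bound
  -- `4`.
  have hsnd : ∀ u v w, T u v → w ≠ u → T u w := by
    intro u v w hT hw
    obtain ⟨k, hku, hkv, hkw⟩ := havoid u v w
    exact hfwd k u w (hbwd u v k hT hku hkv) hkw.symm hw
  have hfst : ∀ u v w x, T u v → w ≠ x → T w x := by
    intro u v w x hT hwx
    by_cases hwu : w = u
    · subst hwu
      exact hsnd w v x hT hwx.symm
    · obtain ⟨k, hku, hkw, -⟩ := havoid u w w
      exact hsnd w k x (hfwd u w k (hsnd u v w hT hwu) hku hkw) hwx.symm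
  obtain ⟨a, ha⟩ := hS
  exact (hfst a.fst a.snd d.fst d.snd ⟨a.fst_ne_snd, ha⟩ d.fst_ne_snd).2

/-- The characteristic polynomial of the base of a surjective covering map of graphs divides the
characteristic polynomial of the total graph. -/
theorem charpoly_dvd_of_covering {W : Type*} [Fintype W] [DecidableEq V] [DecidableEq W]
    {H : SimpleGraph W} [DecidableRel H.Adj] {φ : V → W} (hsurj : Function.Surjective φ)
    (hadj : ∀ u v, G.Adj u v → H.Adj (φ u) (φ v))
    (hlift : ∀ v d, H.Adj (φ v) d → ∃! w, G.Adj v w ∧ φ w = d) :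
    (H.adjMatrix ℤ).charpoly ∣ (G.adjMatrix ℤ).charpoly := by
  obtain ⟨s, hs⟩ := hsurj.hasRightInverse
  -- `P` is the fiber indicator and `L` comes from a section; both sides of the intertwining at `(v,
  -- d)` count the neighbors of `v` above `d`.
  refine Matrix.charpoly_dvd_charpoly_of_intertwine
    (P := Matrix.of fun v d => if φ v = d then 1 else 0)
    (L := Matrix.of fun d v => if v = s d then 1 else 0) ?_ ?_
  · ext a b
    simp only [Matrix.mul_apply, Matrix.of_apply, ite_mul, one_mul, zero_mul, Finset.sum_ite_eq',
      Finset.mem_univ, if_true, hs a, Matrix.one_apply]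
  · ext v d
    simp only [Matrix.mul_apply, adjMatrix_apply, Matrix.of_apply, ite_mul, one_mul, zero_mul,
      Finset.sum_ite_eq, Finset.mem_univ, if_true]
    simp only [← ite_and]
    split_ifs with hd
    · obtain ⟨w, hw, huniq⟩ := hlift v d hd
      rw [Finset.sum_eq_single w (fun x _ hx => if_neg fun hx' => hx (huniq x hx'))
        (fun hx => absurd (Finset.mem_univ w) hx), if_pos hw]
    · refine Finset.sum_eq_zero fun w _ => if_neg ?_
      rintro ⟨hvw, rfl⟩
      exact hd (hadj v w hvw)

end SimpleGraph

theorem mainTheorem4 (p : ℕ) (hp : 2 ≤ p) :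
    (∀ (V : Type*) [Fintype V] [DecidableEq V] [Nonempty V] (G : SimpleGraph V)
        [DecidableRel G.Adj],
      G.StarFree (p + 1) → G.IsRegularOfDegree (2 * p) → G.StarColorable (p + 2) →
      ((Polynomial.X - Polynomial.C (2 * (p : ℤ))) *
          (Polynomial.X + Polynomial.C 2) ^ ((p - 1) * (p + 2) / 2) *
          (Polynomial.X - Polynomial.C 2) ^ (p * (p + 1) / 2) *
          (Polynomial.X - Polynomial.C (p : ℤ) + Polynomial.C 2) ^ (p + 1) *
          (Polynomial.X + Polynomial.C (p : ℤ)) ^ (p + 1)) ∣ (G.adjMatrix ℤ).charpoly) ∧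
    ((⊤ : SimpleGraph (ZMod (p + 2))).lineGraphStar.adjMatrix ℤ).charpoly =
      (Polynomial.X - Polynomial.C (2 * (p : ℤ))) *
        (Polynomial.X + Polynomial.C 2) ^ ((p - 1) * (p + 2) / 2) *
        (Polynomial.X - Polynomial.C 2) ^ (p * (p + 1) / 2) *
        (Polynomial.X - Polynomial.C (p : ℤ) + Polynomial.C 2) ^ (p + 1) *
        (Polynomial.X + Polynomial.C (p : ℤ)) ^ (p + 1) := by
  refine ⟨?_, SimpleGraph.charpoly_lineGraphStar_top hp (ZMod.card _)⟩
  intro V _ _ _ G _ hG hreg ⟨f, hf⟩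
  rw [← SimpleGraph.charpoly_lineGraphStar_top hp (ZMod.card (p + 2))]
  obtain ⟨φ, hadj, hlift⟩ := hf.exists_covering hp hG hreg
  refine SimpleGraph.charpoly_dvd_of_covering (φ := φ) ?_ hadj hlift
  refine SimpleGraph.lineGraphStar_top_closed (by rw [ZMod.card]; omega) (Set.range_nonempty φ) ?_
  rintro _ ⟨v, rfl⟩ d hd
  obtain ⟨w, hw, -⟩ := hlift v d hd
  exact ⟨w, hw.2⟩
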